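/- Let $n,s\ge 0$ and $f_1,\dots,f_s\in\mathbb{R}[x_1,\dots,x_n]$, let $F=(f_1,\dots,f_s):\mathbb{R}^n\to\mathbb{R}^s$, and denote also by $F:\mathbb{C}^n\to\mathbb{C}^s$ its complexification. For $e\in\mathbb{R}^s$ put $$H_e=[-e_1,e_1]\times\dots\times[-e_s,e_s]\quad(\text{where }[-a,a]\text{ means }[a,-a]\text{ if }a<0),$$ $$S_e=F^{-1}(H_e)=\{p\in\mathbb{R}^n : |f_i(p)|\le |e_i|\text{ for }1\le i\le s\}.$$ Let $\mathcal{W}(H_e)$ be the set of all products $I_1\times\dots\times I_s$ where each $I_i$ is $\{-e_i\}$, $\{e_i\}$ or the open interval with end points $-e_i$ and $e_i$, and let $\mathcal{W}(S_e)=\{F^{-1}(A) : A\in\mathcal{W}(H_e)\}$. For $I\subseteq\{1,\dots,s\}$ and $\sigma:I\to\{\pm1\}$ let $J_{I,\sigma}\subseteq\mathbb{R}[x_1,\dots,x_n]$ be the ideal generated by the polynomials $f_i-\sigma_ie_i$ for $i\in I$ and by the $\#I\times\#I$ minors of the $\#I\times n$ matrix $(\partial f_i/\partial x_j)_{i\in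 I,\,1\le j\le n}$, and let $$Y_{I,\sigma}=\{x\in\mathbb{C}^n : f_i(x)=\sigma_ie_i\text{ for all }i\in I,\text{ and } p_I\circ \mathrm{d}_xF:\mathbb{C}^n\to\mathbb{C}^I\text{ is not surjective}\},$$ where $p_I:\mathbb{C}^s\to\mathbb{C}^I$ keeps the coordinates with index in $I$. The algorithm CheckWhitneyStratification, on input $f_1,\dots,f_s$ and $e\in\mathbb{R}^s$, runs through all pairs $(I,\sigma)$ with $I\subseteq\{1,\dots,s\}$, $\#I\le n+1$ and $\sigma:I\to\{\pm1\}$; it returns false as soon as $J_{I,\sigma}\ne\langle1\rangle$ for one of them, and returns true if the loop ends without this. **Proposition.** 1. The algorithm returns true if $e$ is generic: there is a nonzero polynomial $P\in\mathbb{R}[y_1,\dots,y_s]$, depending only on $f_1,\dots,f_s$, such that the algorithm returns true for every $e\in\mathbb{R}^s$ with $P(e)\neq0$. 2. For every $e\in\mathbb{R}^s$, if the algorithm returns true, then $\mathcal{W}(S_e)$ is a Whitney stratification of $S_e$, that is, a locally finite partition of $S_e$ (empty members being disregarded) into smooth embedded submanifolds of $\mathbb{R}^n$ that satisfies the condition of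 the frontier and Whitney's conditions (a) and (b). 3. For every $e\in\mathbb{R}^s$ and all $I,\sigma$, the test of the algorithm detects emptiness of $Y_{I,\sigma}$: $J_{I,\sigma}=\langle1\rangle$ if and only if $Y_{I,\sigma}=\varnothing$. Hence the algorithm returns true if and only if $Y_{I,\sigma}=\varnothing$ for all $I,\sigma$ with $\#I\le n+1$, and this holds if and only if $Y_{I,\sigma}=\varnothing$ for all $I,\sigma$. -/

import Mathlib

open scoped ContDiff Topology

noncomputable section

namespace CheckWhitney

/-! ### Whitney stratifications of subsets of Euclidean space -/

section Stratifications

variable {n : ℕ}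

/-- `A` is a smooth embedded submanifold of `ℝⁿ` (possibly empty, possibly with components of
different dimensions): locally it is the zero set of a smooth submersion to some `ℝᵏ`. -/
def IsSubmanifold (A : Set (EuclideanSpace ℝ (Fin n))) : Prop :=
  ∀ x ∈ A, ∃ (k : ℕ) (U : Set (EuclideanSpace ℝ (Fin n)))
    (g : EuclideanSpace ℝ (Fin n) → Fin k → ℝ),
    IsOpen U ∧ x ∈ U ∧ ContDiffOn ℝ ∞ g U ∧
      (∀ z ∈ U, Function.Surjective (fderiv ℝ g z)) ∧
      A ∩ U = {z ∈ U | g z = 0}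

/-- The velocity vectors at `x` of the smooth curves contained in `A` and passing through `x`. -/
def velocities (A : Set (EuclideanSpace ℝ (Fin n))) (x : EuclideanSpace ℝ (Fin n)) :
    Set (EuclideanSpace ℝ (Fin n)) :=
  {v | ∃ γ : ℝ → EuclideanSpace ℝ (Fin n), ContDiffAt ℝ ∞ γ 0 ∧ γ 0 = x ∧
    (∀ᶠ t in 𝓝 (0 : ℝ), γ t ∈ A) ∧ HasDerivAt γ v 0}

/-- The tangent space of `A` at `x`. When `A` is a submanifold and `x ∈ A`, the velocity vectors
already form a linear subspace, so that taking the span adds nothing. -/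
def tangent (A : Set (EuclideanSpace ℝ (Fin n))) (x : EuclideanSpace ℝ (Fin n)) :
    Submodule ℝ (EuclideanSpace ℝ (Fin n)) :=
  Submodule.span ℝ (velocities A x)

/-- Convergence of a sequence of linear subspaces of `ℝⁿ` in the Grassmannian: convergence of the
orthogonal projections. -/
def SubspaceTendsto (T : ℕ → Submodule ℝ (EuclideanSpace ℝ (Fin n)))
    (τ : Submodule ℝ (EuclideanSpace ℝ (Fin n))) : Prop :=
  Filter.Tendsto (fun k => (T k).starProjection) Filter.atTop (𝓝 τ.starProjection)

/-- Whitney's condition (a) for the pair `(X, Y)`: limits of tangent spaces of `X` at points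
tending to `y ∈ Y` contain the tangent space of `Y` at `y`. -/
def WhitneyA (X Y : Set (EuclideanSpace ℝ (Fin n))) : Prop :=
  ∀ y ∈ Y, ∀ (x : ℕ → EuclideanSpace ℝ (Fin n)) (τ : Submodule ℝ (EuclideanSpace ℝ (Fin n))),
    (∀ k, x k ∈ X) → Filter.Tendsto x Filter.atTop (𝓝 y) →
    SubspaceTendsto (fun k => tangent X (x k)) τ → tangent Y y ≤ τ

/-- Whitney's condition (b) for the pair `(X, Y)`: if `xₖ ∈ X` and `yₖ ∈ Y` tend to the same point
`y ∈ Y`, the secant lines through `xₖ` and `yₖ` tend to a line `l` and the tangent spaces of `X`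
at `xₖ` tend to a subspace `τ`, then `l ⊆ τ`. -/
def WhitneyB (X Y : Set (EuclideanSpace ℝ (Fin n))) : Prop :=
  ∀ y ∈ Y, ∀ (x z : ℕ → EuclideanSpace ℝ (Fin n))
    (l τ : Submodule ℝ (EuclideanSpace ℝ (Fin n))),
    (∀ k, x k ∈ X) → (∀ k, z k ∈ Y) → (∀ k, x k ≠ z k) →
    Filter.Tendsto x Filter.atTop (𝓝 y) → Filter.Tendsto z Filter.atTop (𝓝 y) →
    SubspaceTendsto (fun k => Submodule.span ℝ {x k - z k}) l →
    SubspaceTendsto (fun k => tangent X (x k)) τ → l ≤ τ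

/-- `𝒮` is a Whitney stratification of `S ⊆ ℝⁿ`: a locally finite partition of `S` into smooth
submanifolds (empty members of `𝒮` are allowed and carry no condition) with the condition of the
frontier and Whitney's conditions (a) and (b). -/
structure IsWhitneyStratification (S : Set (EuclideanSpace ℝ (Fin n)))
    (𝒮 : Set (Set (EuclideanSpace ℝ (Fin n)))) : Prop where
  sUnion_eq : ⋃₀ 𝒮 = S
  disjoint : ∀ X ∈ 𝒮, ∀ Y ∈ 𝒮, X ≠ Y → Disjoint X Y
  locallyFinite : ∀ x ∈ S, ∃ U ∈ 𝓝 x, {A ∈ 𝒮 | (A ∩ U).Nonempty}.Finite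
  submanifold : ∀ A ∈ 𝒮, IsSubmanifold A
  frontier : ∀ X ∈ 𝒮, ∀ Y ∈ 𝒮, (Y ∩ closure X).Nonempty → Y ⊆ closure X
  whitneyA : ∀ X ∈ 𝒮, ∀ Y ∈ 𝒮, X ≠ Y → WhitneyA X Y
  whitneyB : ∀ X ∈ 𝒮, ∀ Y ∈ 𝒮, X ≠ Y → WhitneyB X Y

end Stratifications

/-! ### The hypercube, its facets and their pullback -/

section Pullback

variable {n s : ℕ}

/-- The hypercube `[-e₁, e₁] × ⋯ × [-eₛ, eₛ]`, where `[-a, a]` means `[a, -a]` if `a < 0`. -/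
def hypercube (e : Fin s → ℝ) : Set (Fin s → ℝ) :=
  Set.univ.pi fun i => Set.uIcc (-e i) (e i)

/-- The relative interiors of the facets of the hypercube: the products of sets `Iᵢ`, each of which
is `{-eᵢ}`, the open interval with end points `-eᵢ` and `eᵢ`, or `{eᵢ}`. -/
def facetStratification (e : Fin s → ℝ) : Set (Set (Fin s → ℝ)) :=
  {A | ∃ I : Fin s → Set ℝ,
    (∀ i, I i = {-e i} ∨ I i = Set.uIoo (-e i) (e i) ∨ I i = {e i}) ∧ A = Set.univ.pi I}

/-- The real polynomial map `F = (f₁, …, fₛ) : ℝⁿ → ℝˢ`. -/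
def realMap (f : Fin s → MvPolynomial (Fin n) ℝ) (x : EuclideanSpace ℝ (Fin n)) : Fin s → ℝ :=
  fun i => MvPolynomial.eval (fun j => x j) (f i)

/-- `S_e = {p ∈ ℝⁿ : |fᵢ(p)| ≤ |eᵢ| for all i}`. -/
def thickening (f : Fin s → MvPolynomial (Fin n) ℝ) (e : Fin s → ℝ) :
    Set (EuclideanSpace ℝ (Fin n)) :=
  {p | ∀ i, |realMap f p i| ≤ |e i|}

/-- The preimages under `F` of the strata of the hypercube. -/
def pullbackStratification (f : Fin s → MvPolynomial (Fin n) ℝ) (e : Fin s → ℝ) :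
    Set (Set (EuclideanSpace ℝ (Fin n))) :=
  (fun A => realMap f ⁻¹' A) '' facetStratification e

/-- The set `S_e` is the preimage of the hypercube. -/
theorem thickening_eq_preimage (f : Fin s → MvPolynomial (Fin n) ℝ) (e : Fin s → ℝ) :
    thickening f e = realMap f ⁻¹' hypercube e := by
  ext p
  refine forall_congr' fun i => ?_
  simp only [Set.mem_univ, forall_true_left]
  rw [Set.mem_uIcc]
  rcases abs_cases (e i) with h | h <;> rcases abs_cases (realMap f p i) with h' | h' <;> grind

end Pullback

/-! ### The complex varieties `Y_{I,σ}` -/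

section Varieties

variable {n s : ℕ}

/-- The complex polynomial map `F = (f₁, …, fₛ) : ℂⁿ → ℂˢ`. -/
def complexMap (f : Fin s → MvPolynomial (Fin n) ℝ) (x : Fin n → ℂ) : Fin s → ℂ :=
  fun i => MvPolynomial.aeval x (f i)

/-- The linear variety `L_{I,σ} = {y ∈ ℂˢ : yᵢ = σᵢ eᵢ for i ∈ I}`. -/
def linearVariety (e : Fin s → ℝ) (I : Finset (Fin s)) (σ : I → ℤˣ) : Set (Fin s → ℂ) :=
  {y | ∀ i : I, y i = ((σ i : ℤ) : ℂ) * ((e i : ℝ) : ℂ)}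

/-- The variety `Y_{I,σ}` of the `x ∈ ℂⁿ` such that `F(x) ∈ L_{I,σ}` and `p_I ∘ d_x F : ℂⁿ → ℂ^I`
is not surjective, where `p_I` keeps the coordinates with index in `I`. -/
def badVariety (f : Fin s → MvPolynomial (Fin n) ℝ) (e : Fin s → ℝ) (I : Finset (Fin s))
    (σ : I → ℤˣ) : Set (Fin n → ℂ) :=
  {x | complexMap f x ∈ linearVariety e I σ ∧
    ¬ Function.Surjective (fun (v : Fin n → ℂ) (i : I) => fderiv ℂ (complexMap f) x v i)}

end Varieties

/-! ### The algorithm -/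

section Algorithm

variable {n s : ℕ}

/-- The `#I × n` matrix `(∂fᵢ/∂xⱼ)`, with rows indexed by `I`. -/
def jacobian (f : Fin s → MvPolynomial (Fin n) ℝ) (I : Finset (Fin s)) :
    Matrix I (Fin n) (MvPolynomial (Fin n) ℝ) :=
  Matrix.of fun i j => MvPolynomial.pderiv j (f i)

/-- The ideal `⟨fᵢ - σᵢ eᵢ, i ∈ I⟩ + ⟨#I × #I minors of the Jacobian matrix⟩` of `ℝ[x₁, …, xₙ]`.
A minor is given by an injective choice of `#I` columns; the order of the columns only affects
its sign. -/
def testIdeal (f : Fin s → MvPolynomial (Fin n) ℝ) (e : Fin s → ℝ) (I : Finset (Fin s))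
    (σ : I → ℤˣ) : Ideal (MvPolynomial (Fin n) ℝ) :=
  Ideal.span (Set.range fun i : I => f i - MvPolynomial.C (((σ i : ℤ) : ℝ) * e i)) ⊔
    Ideal.span (Set.range fun c : I ↪ Fin n => ((jacobian f I).submatrix id c).det)

/-- The pairs `(I, σ)` visited by the loop: `I ⊆ {1, …, s}` with `#I ≤ n + 1` and
`σ : I → {±1}`. -/
def loopIndices (n s : ℕ) : List (Σ I : Finset (Fin s), (I → ℤˣ)) :=
  (Finset.univ.filter fun p : (Σ I : Finset (Fin s), (I → ℤˣ)) => p.1.card ≤ n + 1).toList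

open Classical in
/-- The algorithm: it runs through the pairs `(I, σ)`, returns `false` as soon as the ideal of one
of them is not the unit ideal, and returns `true` at the end of the loop otherwise. -/
def checkWhitneyStratification (f : Fin s → MvPolynomial (Fin n) ℝ) (e : Fin s → ℝ) : Bool :=
  (loopIndices n s).all fun p => decide (testIdeal f e p.1 p.2 = ⊤)

end Algorithm

end CheckWhitney

end

/-! Genericity is an algebraic Sard theorem. Modulo a prime containing the maximal minors of the
Jacobian matrix, the differentials of the `f i` become linearly dependent; in characteristic zero
this forces an algebraic relation (`exists_aeval_mem_of_minors_mem`). The product of such relations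
over the minimal primes of the ideal of minors vanishes at all critical values, and a product over
all `(I, σ)`, after sign changes, gives the polynomial in `e`.

The test is the Nullstellensatz for real polynomials and complex points (`testIdeal_eq_top_iff`).
More than `n` rows have no maximal minors, so the sets with `n + 1` elements already control all
larger ones.

If every test succeeds, the active components form a submersion `g` along the real level set `g = q`
carrying a stratum `X`, and `X` is open in it. By `eq_of_mem_closure`, a stratum `Y` meeting the
closure of `X` lies in the same level set. Near `Y`, the tangent spaces of `X` are the kernels of
`Dg`, which vary continuously, and secants between points of one level set become tangent to it;
this gives (a) and (b). The frontier condition holds because a submersion is open, so that values on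
a face can be moved into an adjacent larger face. -/

noncomputable section

namespace CheckWhitney

/-! ### Algebraic Sard theorem via Kähler differentials -/

section Algebra

/-- A matrix has full row rank if and only if one of its maximal minors is nonzero. -/
theorem surjective_mulVec_iff_exists_det_ne_zero {K ι : Type*} [Field K] [Fintype ι]
    [DecidableEq ι] {n : ℕ} (M : Matrix ι (Fin n) K) :
    Function.Surjective M.mulVec ↔ ∃ c : ι ↪ Fin n, (M.submatrix id c).det ≠ 0 := by
  constructor
  · intro h
    have hspan : Submodule.span K (Set.range M.col) = ⊤ := by
      rw [← Matrix.range_mulVecLin]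
      exact LinearMap.range_eq_top.2 h
    -- A maximal independent subfamily of the columns is a basis of `ι → K`, so it has as many
    -- members as `ι` and selects an invertible square submatrix.
    obtain ⟨κ, a, ha, hs, hli⟩ := exists_linearIndependent' K M.col
    have : Finite κ := Finite.of_injective a ha
    have := Fintype.ofFinite κ
    rw [hspan] at hs
    let b := Module.Basis.mk hli hs.ge
    let φ : ι ≃ κ := (Pi.basisFun K ι).indexEquiv b
    refine ⟨⟨fun i => a (φ i), ha.comp φ.injective⟩, ?_⟩
    have : LinearIndependent K (M.submatrix id fun i => a (φ i)).col :=
      hli.comp φ φ.injective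
    rw [Matrix.linearIndependent_cols_iff_isUnit, Matrix.isUnit_iff_isUnit_det] at this
    exact this.ne_zero
  · rintro ⟨c, hc⟩ y
    have hu : IsUnit (M.submatrix id c) := by
      rw [Matrix.isUnit_iff_isUnit_det]; exact hc.isUnit
    obtain ⟨w, hw⟩ := Matrix.mulVec_surjective_iff_isUnit.2 hu y
    refine ⟨fun j => ∑ i, if c i = j then w i else 0, ?_⟩
    rw [← hw]
    ext i
    simp only [Matrix.mulVec, dotProduct, Matrix.submatrix_apply, id, Finset.mul_sum]
    rw [Finset.sum_comm]
    simp

/-- A proper range lies in the kernel of a nonzero functional, whose coordinates are `a`. -/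
theorem exists_vecMul_eq_zero {K ι κ : Type*} [Field K] [Fintype ι] [Fintype κ]
    (M : Matrix ι κ K) (h : ¬ Function.Surjective M.mulVec) :
    ∃ a : ι → K, a ≠ 0 ∧ Matrix.vecMul a M = 0 := by
  classical
  have h1 : LinearMap.range M.mulVecLin < ⊤ := by
    rw [lt_top_iff_ne_top, Ne, LinearMap.range_eq_top]; exact h
  obtain ⟨φ, hφ, hle⟩ := Submodule.exists_le_ker_of_lt_top _ h1
  have key (v : ι → K) : φ v = dotProduct (fun i => φ (Pi.single i 1)) v := by
    conv_lhs => rw [← Finset.univ_sum_single v]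
    simp only [map_sum, dotProduct]
    refine Finset.sum_congr rfl fun i _ => ?_
    rw [mul_comm, ← smul_eq_mul, ← map_smul, ← Pi.single_smul]; simp
  refine ⟨fun i => φ (Pi.single i 1), fun h0 => hφ ?_, ?_⟩
  · ext v; simp [congrFun h0]
  · ext j
    have := hle ⟨Pi.single j 1, rfl⟩
    rw [LinearMap.mem_ker, key] at this
    simpa [Matrix.vecMul, dotProduct] using this

/-- Over a field of characteristic zero, algebraically independent elements have linearly
independent differentials. -/
theorem linearIndependent_D_of_algebraicIndependent {k L ι : Type} [Field k] [Field L]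
    [Algebra k L] [CharZero k] {y : ι → L} (hy : AlgebraicIndependent k y) :
    LinearIndependent L fun i => KaehlerDifferential.D k L (y i) := by
  classical
  obtain ⟨t, hyt, ht⟩ := exists_isTranscendenceBasis_superset
    ((algebraicIndependent_subtype_range hy.injective).2 hy)
  let v : t → L := Subtype.val
  let S := MvPolynomial t k
  let : Algebra S L := (MvPolynomial.aeval v).toAlgebra
  have : IsScalarTower k S L := IsScalarTower.of_algHom (MvPolynomial.aeval v)
  have hinj : Function.Injective (algebraMap S L) := ht.1
  have : FaithfulSMul S L := (faithfulSMul_iff_algebraMap_injective S L).2 hinj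
  have halg : Algebra.IsAlgebraic (Algebra.adjoin k (Set.range v)) L := ht.isAlgebraic
  have : Algebra.IsAlgebraic S L :=
    .of_ringHom_of_comp_eq ht.1.aevalEquiv.toRingEquiv.toRingHom (RingHom.id L)
      ht.1.aevalEquiv.surjective Function.injective_id
      (RingHom.ext fun p => ht.1.algebraMap_aevalEquiv p)
  let : Algebra (FractionRing S) L := FractionRing.liftAlgebra S L
  have : Algebra.IsAlgebraic (FractionRing S) L :=
    (IsFractionRing.comap_isAlgebraic_iff (A := S)).1 inferInstance
  -- Localizations and separable algebraic extensions are formally étale. Hence the differentials of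
  -- `L` are those of the polynomial ring `S` after base change, and the `D` of a transcendence
  -- basis form a basis.
  have : Algebra.FormallyEtale S (FractionRing S) := .of_isLocalization (nonZeroDivisors S)
  have : Algebra.FormallyEtale (FractionRing S) L := .of_isSeparable _ _
  have : Algebra.FormallyEtale S L := .comp S (FractionRing S) L
  let b := ((KaehlerDifferential.mvPolynomialBasis k t).baseChange L).map
    (KaehlerDifferential.tensorKaehlerEquivOfFormallyEtale k S L)
  have hb (i : t) : b i = KaehlerDifferential.D k L i := by
    have h := (KaehlerDifferential.tensorKaehlerEquivOfFormallyEtale k S L).symm_apply_eq.1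
      (KaehlerDifferential.tensorKaehlerEquivOfFormallyEtale_symm_D_algebraMap k S L
        (MvPolynomial.X i))
    have hX : algebraMap S L (MvPolynomial.X i) = i := MvPolynomial.aeval_X v i
    rw [hX] at h
    simp only [b, Module.Basis.map_apply, Module.Basis.baseChange_apply,
      KaehlerDifferential.mvPolynomialBasis_apply]
    exact h.symm
  have hφ (i : ι) : y i ∈ t := hyt ⟨i, rfl⟩
  have := b.linearIndependent.comp (fun i => (⟨y i, hφ i⟩ : t))
    fun i j h => hy.injective (congrArg Subtype.val h)
  simpa [Function.comp_def, hb] using this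

theorem D_algHom_mvPolynomial {k L : Type} [Field k] [Field L] [Algebra k L] {n : ℕ}
    (φ : MvPolynomial (Fin n) k →ₐ[k] L) (p : MvPolynomial (Fin n) k) :
    KaehlerDifferential.D k L (φ p) =
      ∑ j, φ (MvPolynomial.pderiv j p) • KaehlerDifferential.D k L (φ (MvPolynomial.X j)) := by
  classical
  induction p using MvPolynomial.induction_on with
  | C a => simp [← MvPolynomial.algebraMap_eq]
  | add p q hp hq => simp [hp, hq, add_smul, Finset.sum_add_distrib]
  | mul_X p i hp =>
    rw [map_mul, Derivation.leibniz, hp]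
    simp only [Derivation.leibniz, MvPolynomial.pderiv_X, smul_eq_mul, map_add, map_mul, add_smul,
      Finset.sum_add_distrib, mul_smul, ← Finset.smul_sum]
    congr 1
    rw [Finset.sum_eq_single i] <;> simp +contextual

/-- If the minors of the Jacobian matrix of `f` lie in a prime ideal, then the members of `f`
are algebraically dependent modulo this ideal. -/
theorem exists_aeval_mem_of_minors_mem {k ι : Type} [Field k] [CharZero k] [Fintype ι]
    [DecidableEq ι] {n : ℕ} (f : ι → MvPolynomial (Fin n) k) (p : Ideal (MvPolynomial (Fin n) k))
    [p.IsPrime] (hp : ∀ c : ι ↪ Fin n,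
      ((Matrix.of fun i j => MvPolynomial.pderiv j (f i)).submatrix id c).det ∈ p) :
    ∃ P : MvPolynomial ι k, P ≠ 0 ∧ MvPolynomial.aeval f P ∈ p := by
  by_contra! hcon
  let A := MvPolynomial (Fin n) k ⧸ p
  let L := FractionRing A
  let φ : MvPolynomial (Fin n) k →ₐ[k] L :=
    (IsScalarTower.toAlgHom k A L).comp (Ideal.Quotient.mkₐ k p)
  have hφ (q : MvPolynomial (Fin n) k) : φ q = 0 ↔ q ∈ p := by
    rw [← Ideal.Quotient.eq_zero_iff_mem]
    exact (IsFractionRing.injective A L).eq_iff' (map_zero _)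
  have hy : AlgebraicIndependent k fun i => φ (f i) := by
    rw [algebraicIndependent_iff]
    intro P hP
    by_contra h0
    refine hcon P h0 ((hφ _).1 ?_)
    rw [← hP, MvPolynomial.comp_aeval_apply]
  have hli := linearIndependent_D_of_algebraicIndependent hy
  let M : Matrix ι (Fin n) L := Matrix.of fun i j => φ (MvPolynomial.pderiv j (f i))
  have hM : ¬ Function.Surjective M.mulVec := by
    rw [surjective_mulVec_iff_exists_det_ne_zero]
    rintro ⟨c, hc⟩
    refine hc ?_
    rw [← (hφ _).2 (hp c), AlgHom.map_det]
    rfl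
  obtain ⟨a, ha, haM⟩ := exists_vecMul_eq_zero M hM
  -- By the chain rule, a left null vector of the Jacobian matrix is a linear relation between the
  -- differentials of the `φ (f i)`, so it must be zero.
  refine ha (funext fun i => (Fintype.linearIndependent_iff.1 hli) a ?_ i)
  have hD (i : ι) := D_algHom_mvPolynomial φ (f i)
  simp only [hD, Finset.smul_sum, smul_smul]
  rw [Finset.sum_comm]
  refine Finset.sum_eq_zero fun j _ => ?_
  rw [← Finset.sum_smul]
  have := congrFun haM j
  simp only [Matrix.vecMul, dotProduct, M, Matrix.of_apply, Pi.zero_apply] at this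
  rw [this, zero_smul]

/-- Algebraic Sard theorem: some nonzero polynomial vanishes on all critical values of `f`. -/
theorem exists_aeval_mem_radical_minors {k ι : Type} [Field k] [CharZero k] [Fintype ι]
    [DecidableEq ι] {n : ℕ} (f : ι → MvPolynomial (Fin n) k) :
    ∃ P : MvPolynomial ι k, P ≠ 0 ∧ MvPolynomial.aeval f P ∈
      (Ideal.span (Set.range fun c : ι ↪ Fin n =>
        ((Matrix.of fun i j => MvPolynomial.pderiv j (f i)).submatrix id c).det)).radical := by
  set J := Ideal.span (Set.range fun c : ι ↪ Fin n =>
        ((Matrix.of fun i j => MvPolynomial.pderiv j (f i)).submatrix id c).det) with hJ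
  have hfin := Ideal.finite_minimalPrimes_of_isNoetherianRing _ J
  have key (p : Ideal (MvPolynomial (Fin n) k)) (hp : p ∈ J.minimalPrimes) :
      ∃ P : MvPolynomial ι k, P ≠ 0 ∧ MvPolynomial.aeval f P ∈ p :=
    have := hp.1.1
    exists_aeval_mem_of_minors_mem f p fun c => hp.1.2 (Ideal.subset_span ⟨c, rfl⟩)
  choose! P hP0 hP using key
  refine ⟨∏ p ∈ hfin.toFinset, P p, Finset.prod_ne_zero_iff.2 fun p hp =>
    hP0 p (hfin.mem_toFinset.1 hp), ?_⟩
  rw [← Ideal.sInf_minimalPrimes, Submodule.mem_sInf]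
  intro p hp
  rw [map_prod]
  exact Ideal.mem_of_dvd _ (Finset.dvd_prod_of_mem _ (hfin.mem_toFinset.2 hp)) (hP p hp)

end Algebra

/-! ### Formal and analytic derivatives of polynomial maps -/

section Derivatives

theorem hasFDerivAt_aeval {k 𝕜 : Type*} [CommSemiring k] [NontriviallyNormedField 𝕜]
    [Algebra k 𝕜] {n : ℕ} (p : MvPolynomial (Fin n) k) (x : Fin n → 𝕜) :
    HasFDerivAt (fun y : Fin n → 𝕜 => MvPolynomial.aeval y p)
      (∑ j, MvPolynomial.aeval x (MvPolynomial.pderiv j p) •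
        (ContinuousLinearMap.proj j : (Fin n → 𝕜) →L[𝕜] 𝕜)) x := by
  classical
  induction p using MvPolynomial.induction_on with
  | C a =>
    simp only [MvPolynomial.aeval_C]
    exact (hasFDerivAt_const _ x).congr_fderiv (by ext v; simp)
  | add p q hp hq =>
    simp only [map_add]
    exact (hp.fun_add hq).congr_fderiv (by ext v; simp [add_mul, Finset.sum_add_distrib])
  | mul_X p i hp =>
    simp only [map_mul, MvPolynomial.aeval_X]
    refine (hp.fun_mul (hasFDerivAt_apply i x)).congr_fderiv ?_
    ext v
    simp [Derivation.leibniz, MvPolynomial.pderiv_X, add_mul, Finset.sum_add_distrib, mul_assoc,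
      Finset.mul_sum, Pi.single_apply, apply_ite]

variable {n s : ℕ}

theorem fderiv_complexMap_apply (f : Fin s → MvPolynomial (Fin n) ℝ) (x v : Fin n → ℂ)
    (i : Fin s) : fderiv ℂ (complexMap f) x v i =
      ∑ j, MvPolynomial.aeval x (MvPolynomial.pderiv j (f i)) * v j := by
  have h : HasFDerivAt (complexMap f) _ x :=
    hasFDerivAt_pi.2 fun i => hasFDerivAt_aeval (f i) x
  rw [h.fderiv]
  simp

theorem fderiv_realMap_apply (f : Fin s → MvPolynomial (Fin n) ℝ)
    (x v : EuclideanSpace ℝ (Fin n)) (i : Fin s) : fderiv ℝ (realMap f) x v i =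
      ∑ j, MvPolynomial.eval x (MvPolynomial.pderiv j (f i)) * v j := by
  have h : HasFDerivAt (realMap f) _ x := hasFDerivAt_pi.2 fun i =>
    (hasFDerivAt_aeval (f i) (x : Fin n → ℝ)).comp x
      (EuclideanSpace.equiv (Fin n) ℝ).hasFDerivAt
  rw [h.fderiv]
  simp [MvPolynomial.aeval_eq_eval]

theorem contDiff_realMap (f : Fin s → MvPolynomial (Fin n) ℝ) : ContDiff ℝ ∞ (realMap f) := by
  refine contDiff_pi.2 fun i => ?_
  have := (AnalyticOnNhd.eval_mvPolynomial (𝕜 := ℝ) (f i)).contDiff (n := ∞)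
  exact this.comp (EuclideanSpace.equiv (Fin n) ℝ).contDiff

end Derivatives

/-! ### The ideal test, its complex zeros and generic success -/

section Test

variable {n s : ℕ}

/-- The Jacobian matrix at a point has full row rank if and only if some minor does not vanish
there. -/
theorem surjective_sum_mul_iff {K : Type*} [Field K] [Algebra ℝ K]
    (f : Fin s → MvPolynomial (Fin n) ℝ) (I : Finset (Fin s)) (x : Fin n → K) :
    Function.Surjective (fun (v : Fin n → K) (i : I) =>
      ∑ j, MvPolynomial.aeval x (MvPolynomial.pderiv j (f i)) * v j) ↔
    ∃ c : I ↪ Fin n, MvPolynomial.aeval x ((jacobian f I).submatrix id c).det ≠ 0 := by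
  have h := surjective_mulVec_iff_exists_det_ne_zero
    (Matrix.of fun (i : I) j => MvPolynomial.aeval x (MvPolynomial.pderiv j (f i)))
  convert! h using 4 with c
  rw [AlgHom.map_det]
  rfl

theorem mem_zeroLocus_testIdeal_iff {K : Type*} [Field K] [Algebra ℝ K]
    (f : Fin s → MvPolynomial (Fin n) ℝ) (e : Fin s → ℝ) (I : Finset (Fin s)) (σ : I → ℤˣ)
    (x : Fin n → K) : x ∈ MvPolynomial.zeroLocus K (testIdeal f e I σ) ↔
      (∀ i : I, MvPolynomial.aeval x (f i) = algebraMap ℝ K ((σ i : ℤ) * e i)) ∧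
        ∀ c : I ↪ Fin n, MvPolynomial.aeval x ((jacobian f I).submatrix id c).det = 0 := by
  rw [testIdeal, ← Ideal.span_union, MvPolynomial.zeroLocus_span]
  simp only [Set.mem_ofPred_eq, Set.mem_union, or_imp, forall_and, Set.forall_mem_range, map_sub,
    MvPolynomial.aeval_C, sub_eq_zero]

theorem badVariety_eq_zeroLocus (f : Fin s → MvPolynomial (Fin n) ℝ) (e : Fin s → ℝ)
    (I : Finset (Fin s)) (σ : I → ℤˣ) :
    badVariety f e I σ = MvPolynomial.zeroLocus ℂ (testIdeal f e I σ) := by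
  ext x
  have h := surjective_sum_mul_iff f I x
  simp only [badVariety, Set.mem_ofPred_eq, fderiv_complexMap_apply, h, mem_zeroLocus_testIdeal_iff]
  simp [linearVariety, complexMap]

theorem testIdeal_eq_top_iff (f : Fin s → MvPolynomial (Fin n) ℝ) (e : Fin s → ℝ)
    (I : Finset (Fin s)) (σ : I → ℤˣ) :
    testIdeal f e I σ = ⊤ ↔ badVariety f e I σ = ∅ := by
  rw [badVariety_eq_zeroLocus]
  constructor
  · intro h
    rw [h]
    exact MvPolynomial.zeroLocus_top
  · intro h
    -- The Nullstellensatz in the form needed: the ideal is real, its zeros are taken in the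
    -- algebraically closed extension `ℂ`.
    rw [← Ideal.radical_eq_top, ← MvPolynomial.vanishingIdeal_zeroLocus_eq_radical (K := ℂ), h,
      MvPolynomial.vanishingIdeal_empty]

theorem check_eq_true_iff (f : Fin s → MvPolynomial (Fin n) ℝ) (e : Fin s → ℝ) :
    checkWhitneyStratification f e = true ↔
      ∀ (I : Finset (Fin s)) (σ : I → ℤˣ), I.card ≤ n + 1 → badVariety f e I σ = ∅ := by
  simp [checkWhitneyStratification, loopIndices, testIdeal_eq_top_iff, Sigma.forall]

/-- Surjectivity onto more than `n` coordinates is impossible, so for such a `J` only the equations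
matter, and these are inherited from `I`. -/
theorem mem_badVariety_mono {f : Fin s → MvPolynomial (Fin n) ℝ} {e : Fin s → ℝ}
    {I J : Finset (Fin s)} (hJI : J ⊆ I) (hJ : n < J.card) {σ : I → ℤˣ} {x : Fin n → ℂ}
    (hx : x ∈ badVariety f e I σ) :
    x ∈ badVariety f e J fun i => σ ⟨i, hJI i.2⟩ := by
  refine ⟨fun i => hx.1 ⟨i, hJI i.2⟩, fun h => ?_⟩
  simp only [fderiv_complexMap_apply] at h
  obtain ⟨c, -⟩ := (surjective_sum_mul_iff f J x).1 h
  have := Fintype.card_le_of_embedding c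
  simp at this
  omega

theorem check_eq_true_iff_forall (f : Fin s → MvPolynomial (Fin n) ℝ) (e : Fin s → ℝ) :
    checkWhitneyStratification f e = true ↔
      ∀ (I : Finset (Fin s)) (σ : I → ℤˣ), badVariety f e I σ = ∅ := by
  rw [check_eq_true_iff]
  refine ⟨fun h I σ => ?_, fun h I σ _ => h I σ⟩
  by_cases hI : I.card ≤ n + 1
  · exact h I σ hI
  · obtain ⟨J, hJI, hJ⟩ := Finset.exists_subset_card_eq (s := I) (n := n + 1) (by omega)
    refine Set.eq_empty_iff_forall_notMem.2 fun x hx => ?_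
    have := mem_badVariety_mono hJI (by omega) hx
    rw [h J _ hJ.le] at this
    exact this

/-- A real point satisfying the equations with all minors zero would be a zero of the unit ideal. -/
theorem surjective_fderiv_realMap {f : Fin s → MvPolynomial (Fin n) ℝ} {e : Fin s → ℝ}
    {I : Finset (Fin s)} {σ : I → ℤˣ} (h : testIdeal f e I σ = ⊤) {x : EuclideanSpace ℝ (Fin n)}
    (hx : ∀ i : I, realMap f x i = ((σ i : ℤ) : ℝ) * e i) :
    Function.Surjective fun (v : EuclideanSpace ℝ (Fin n)) (i : I) =>
      fderiv ℝ (realMap f) x v i := by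
  simp only [fderiv_realMap_apply]
  have key := surjective_sum_mul_iff f I (x : Fin n → ℝ)
  simp only [MvPolynomial.aeval_eq_eval] at key
  have : Function.Surjective (fun (v : Fin n → ℝ) (i : I) =>
      ∑ j, MvPolynomial.eval x (MvPolynomial.pderiv j (f i)) * v j) := by
    refine key.2 ?_
    by_contra! hc
    have h0 : x.ofLp ∈ MvPolynomial.zeroLocus ℝ (testIdeal f e I σ) := by
      rw [mem_zeroLocus_testIdeal_iff]
      simp only [MvPolynomial.aeval_eq_eval]
      exact ⟨hx, hc⟩
    rw [h, MvPolynomial.zeroLocus_top] at h0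
    exact h0
  exact this.comp (EuclideanSpace.equiv (Fin n) ℝ).surjective

/-- The algorithm succeeds away from a proper algebraic subset. -/
theorem exists_generic (f : Fin s → MvPolynomial (Fin n) ℝ) :
    ∃ P : MvPolynomial (Fin s) ℝ, P ≠ 0 ∧ ∀ e : Fin s → ℝ,
      MvPolynomial.eval e P ≠ 0 → checkWhitneyStratification f e = true := by
  have key (I : Finset (Fin s)) := exists_aeval_mem_radical_minors fun i : I => f i
  choose Q hQ0 hQ using key
  let g (p : Σ I : Finset (Fin s), (I → ℤˣ)) : MvPolynomial (Fin s) ℝ :=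
    MvPolynomial.bind₁ (fun i : p.1 => MvPolynomial.C ((p.2 i : ℤ) : ℝ) * MvPolynomial.X (i : Fin s))
      (Q p.1)
  have hg (p) : g p ≠ 0 := by
    intro h0
    -- A left inverse of the signed substitution defining `g p`, since signs square to `1`; it shows
    -- that the substitution does not kill `Q p.1`.
    let b : MvPolynomial (Fin s) ℝ →ₐ[ℝ] MvPolynomial p.1 ℝ := MvPolynomial.aeval fun i =>
      if h : i ∈ p.1 then MvPolynomial.C ((p.2 ⟨i, h⟩ : ℤ) : ℝ) * MvPolynomial.X ⟨i, h⟩ else 0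
    have hb : b (g p) = Q p.1 := by
      have : b.comp (MvPolynomial.bind₁ fun i : p.1 =>
          MvPolynomial.C ((p.2 i : ℤ) : ℝ) * MvPolynomial.X (i : Fin s)) = AlgHom.id ℝ _ := by
        ext i : 1
        have hsq : ((p.2 i : ℤ) : ℝ) * ((p.2 i : ℤ) : ℝ) = 1 := by
          rcases Int.units_eq_one_or (p.2 i) with h | h <;> simp [h]
        simp only [AlgHom.comp_apply, MvPolynomial.bind₁_X_right, map_mul, b,
          MvPolynomial.aeval_X, MvPolynomial.algHom_C, MvPolynomial.algebraMap_eq, i.2, dif_pos,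
          AlgHom.id_apply]
        rw [← mul_assoc, ← map_mul, hsq, map_one, one_mul]
      exact DFunLike.congr_fun this (Q p.1)
    rw [h0, map_zero] at hb
    exact hQ0 p.1 hb.symm
  refine ⟨∏ p, g p, Finset.prod_ne_zero_iff.2 fun p _ => hg p, fun e he => ?_⟩
  rw [check_eq_true_iff_forall]
  intro I σ
  refine Set.eq_empty_iff_forall_notMem.2 fun x hx => ?_
  rw [map_prod, Finset.prod_ne_zero_iff] at he
  refine he ⟨I, σ⟩ (Finset.mem_univ _) ?_
  have hx' := hx
  rw [badVariety_eq_zeroLocus] at hx'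
  -- The vanishing of the minors at `x` annihilates `Q I` evaluated at `f`; the equations at `x`
  -- then identify this value with that of `g ⟨I, σ⟩` at `e`.
  have h1 := MvPolynomial.zeroLocus_anti_mono (K := ℂ) (le_sup_right : _ ≤ testIdeal f e I σ) hx'
  have h2 := MvPolynomial.radical_le_vanishingIdeal_zeroLocus (K := ℂ) _ (hQ I) x h1
  let w (i : I) : ℝ := (σ i : ℤ) * e i
  have hw : MvPolynomial.eval e (g ⟨I, σ⟩) = MvPolynomial.aeval w (Q I) := by
    rw [← MvPolynomial.aeval_eq_eval, MvPolynomial.aeval_bind₁]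
    simp [w]
  have h3 : MvPolynomial.aeval x (MvPolynomial.aeval (fun i : I => f i) (Q I)) =
      ((MvPolynomial.eval e (g ⟨I, σ⟩) : ℝ) : ℂ) := by
    have h4 (i : I) : MvPolynomial.aeval x (f i) = algebraMap ℝ ℂ (w i) := by
      simpa [complexMap, w] using hx.1 i
    rw [MvPolynomial.comp_aeval_apply, hw]
    simp only [h4]
    exact MvPolynomial.aeval_algebraMap_apply ℂ w (Q I)
  rw [h3] at h2
  exact_mod_cast h2

end Test

/-! ### Stability of surjective operators and of their kernels -/

section Submersions

open Filter

variable {E F : Type*} [NormedAddCommGroup E] [NormedSpace ℝ E]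
  [NormedAddCommGroup F] [NormedSpace ℝ F]

theorem tendsto_clm_apply {A : ℕ → E →L[ℝ] F} {B : E →L[ℝ] F} {u : ℕ → E} {v : E}
    (hA : Tendsto A atTop (𝓝 B)) (hu : Tendsto u atTop (𝓝 v)) :
    Tendsto (fun k => A k (u k)) atTop (𝓝 (B v)) :=
  (isBoundedBilinearMap_apply.continuous.tendsto (B, v)).comp (hA.prodMk_nhds hu)

variable [FiniteDimensional ℝ F]

theorem exists_continuousLinearMap_rightInverse {A : E →L[ℝ] F} (hA : Function.Surjective A) :
    ∃ R : F →L[ℝ] E, A ∘L R = 1 := by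
  obtain ⟨R, hR⟩ := (A : E →ₗ[ℝ] F).exists_rightInverse_of_surjective (LinearMap.range_eq_top.2 hA)
  exact ⟨LinearMap.toContinuousLinearMap R, ContinuousLinearMap.ext fun v => LinearMap.congr_fun hR v⟩

/-- If `R` is a right inverse of `A`, then `B ∘L R` is close to `1`, hence invertible, for `B` near
`A`. -/
theorem isOpen_setOf_surjective : IsOpen {A : E →L[ℝ] F | Function.Surjective A} := by
  have : CompleteSpace F := FiniteDimensional.complete ℝ F
  rw [isOpen_iff_mem_nhds]
  intro A hA
  obtain ⟨R, hR⟩ := exists_continuousLinearMap_rightInverse hA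
  have hc : Continuous fun B : E →L[ℝ] F => B ∘L R := by fun_prop
  have h1 : {B : F →L[ℝ] F | IsUnit B} ∈ 𝓝 (A ∘L R) :=
    Units.isOpen.mem_nhds (by rw [hR]; exact isUnit_one)
  filter_upwards [hc.continuousAt.preimage_mem_nhds h1] with B hB
  obtain ⟨u, hu⟩ : IsUnit (B ∘L R) := hB
  intro y
  refine ⟨R ((↑u⁻¹ : F →L[ℝ] F) y), ?_⟩
  have : (B ∘L R) * (↑u⁻¹ : F →L[ℝ] F) = 1 := by rw [← hu]; exact u.mul_inv
  exact DFunLike.congr_fun this y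

/-- Vectors that are asymptotically annihilated by operators converging to a surjective operator
are asymptotic to vectors of the kernels. -/
theorem exists_mem_ker_tendsto_sub {A : ℕ → E →L[ℝ] F} {B : E →L[ℝ] F}
    (hA : Tendsto A atTop (𝓝 B)) (hB : Function.Surjective B) {u : ℕ → E}
    (hu : Tendsto (fun k => A k (u k)) atTop (𝓝 0)) :
    ∃ w : ℕ → E, (∀ᶠ k in atTop, A k (w k) = 0) ∧ Tendsto (fun k => w k - u k) atTop (𝓝 0) := by
  have : CompleteSpace F := FiniteDimensional.complete ℝ F
  obtain ⟨R, hR⟩ := exists_continuousLinearMap_rightInverse hB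
  have hc : Continuous fun B : E →L[ℝ] F => B ∘L R := by fun_prop
  have hAR : Tendsto (fun k => A k ∘L R) atTop (𝓝 1) := hR ▸ (hc.tendsto B).comp hA
  have hinv : Tendsto (fun k => Ring.inverse (A k ∘L R)) atTop (𝓝 1) := by
    have h := (NormedRing.inverse_continuousAt (1 : (F →L[ℝ] F)ˣ)).tendsto
    simp only [Units.val_one, Ring.inverse_one] at h
    exact h.comp hAR
  -- Newton-type correction: `R (A R)⁻¹` is a right inverse of `A k` once `A k ∘L R` is invertible,
  -- and the correction tends to zero with `A k (u k)`.
  refine ⟨fun k => u k - R (Ring.inverse (A k ∘L R) (A k (u k))), ?_, ?_⟩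
  · have h1 : ∀ᶠ B : F →L[ℝ] F in 𝓝 1, IsUnit B := Units.isOpen.mem_nhds isUnit_one
    filter_upwards [hAR.eventually h1] with k hk
    have h2 := DFunLike.congr_fun (Ring.mul_inverse_cancel _ hk) (A k (u k))
    rw [map_sub, sub_eq_zero]
    exact h2.symm
  · have h1 : Tendsto (fun k => Ring.inverse (A k ∘L R) (A k (u k))) atTop (𝓝 0) := by
      simpa using tendsto_clm_apply hinv hu
    have h2 := (R.continuous.tendsto 0).comp h1
    simpa using h2.neg

end Submersions

/-! ### Tangent spaces of level sets and Whitney's conditions -/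

section Tangent

open Filter

variable {n : ℕ} {F : Type*} [NormedAddCommGroup F] [NormedSpace ℝ F]

theorem mem_of_tendsto_subspace {T : ℕ → Submodule ℝ (EuclideanSpace ℝ (Fin n))}
    {τ : Submodule ℝ (EuclideanSpace ℝ (Fin n))} (hT : SubspaceTendsto T τ)
    {v : ℕ → EuclideanSpace ℝ (Fin n)} {v₀ : EuclideanSpace ℝ (Fin n)}
    (hv : ∀ᶠ k in atTop, v k ∈ T k) (hv₀ : Tendsto v atTop (𝓝 v₀)) : v₀ ∈ τ := by
  rw [← Submodule.starProjection_eq_self_iff]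
  have h1 := tendsto_clm_apply hT hv₀
  refine tendsto_nhds_unique (h1.congr' ?_) hv₀
  filter_upwards [hv] with k hk
  exact Submodule.starProjection_eq_self_iff.2 hk

theorem tangent_le_ker_fderiv {g : EuclideanSpace ℝ (Fin n) → F}
    {A : Set (EuclideanSpace ℝ (Fin n))} {x v : EuclideanSpace ℝ (Fin n)}
    (hg : DifferentiableAt ℝ g x)
    (hA : ∀ z ∈ A, g z = g x) (hv : v ∈ tangent A x) : fderiv ℝ g x v = 0 := by
  suffices h : tangent A x ≤ LinearMap.ker (fderiv ℝ g x : _ →ₗ[ℝ] F) from h hv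
  refine Submodule.span_le.2 ?_
  rintro v ⟨γ, -, h0, hγ, hd⟩
  have h1 : HasDerivAt (g ∘ γ) (fderiv ℝ g x v) 0 := by
    subst h0
    exact hg.hasFDerivAt.comp_hasDerivAt 0 hd
  have h2 : HasDerivAt (g ∘ γ) 0 0 :=
    (hasDerivAt_const 0 (g x)).congr_of_eventuallyEq (by filter_upwards [hγ] with t ht using hA _ ht)
  exact h1.unique h2

variable [FiniteDimensional ℝ F]

/-- The line `x + t v` stays in the level set to first order; the implicit function theorem corrects
it by `R (ψ t)` with `ψ` of zero derivative, giving a curve of velocity `v`. -/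
theorem ker_fderiv_le_tangent {g : EuclideanSpace ℝ (Fin n) → F} (hg : ContDiff ℝ ∞ g)
    {A : Set (EuclideanSpace ℝ (Fin n))} {x : EuclideanSpace ℝ (Fin n)}
    (hx : Function.Surjective (fderiv ℝ g x)) (hA : ∀ᶠ z in 𝓝 x, g z = g x → z ∈ A)
    {v : EuclideanSpace ℝ (Fin n)} (hv : fderiv ℝ g x v = 0) : v ∈ tangent A x := by
  have : CompleteSpace F := FiniteDimensional.complete ℝ F
  obtain ⟨R, hR⟩ := exists_continuousLinearMap_rightInverse hx
  let a : ℝ × F →L[ℝ] EuclideanSpace ℝ (Fin n) :=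
    (ContinuousLinearMap.fst ℝ ℝ F).smulRight v + R ∘L ContinuousLinearMap.snd ℝ ℝ F
  let h : ℝ × F → F := fun q => g (x + a q)
  have hh : ContDiffAt ℝ ∞ h 0 := by
    have : ContDiff ℝ ∞ h := hg.comp (contDiff_const.add a.contDiff)
    exact this.contDiffAt
  have hd : fderiv ℝ h 0 = fderiv ℝ g x ∘L a := by
    have h1 : HasFDerivAt (fun q => x + a q) a 0 := a.hasFDerivAt.const_add x
    have h2 : HasFDerivAt g (fderiv ℝ g x) (x + a 0) := by
      rw [map_zero, add_zero]
      exact (hg.differentiable (by simp) x).hasFDerivAt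
    exact (h2.comp 0 h1).fderiv
  have hinr : fderiv ℝ h 0 ∘L .inr ℝ ℝ F = 1 := by
    rw [hd, ← hR]
    ext w
    simp [a]
  have hinl : fderiv ℝ h 0 ∘L .inl ℝ ℝ F = 0 := by
    rw [hd]
    ext
    simp [a, hv]
  have hi : (fderiv ℝ h 0 ∘L .inr ℝ ℝ F).IsInvertible := by
    rw [hinr]
    exact ⟨ContinuousLinearEquiv.refl ℝ F, rfl⟩
  let ψ := hh.implicitFunction (by simp) hi
  have hψ0 : ψ 0 = 0 := hh.implicitFunction_apply_self (by simp) hi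
  have hψ : ∀ᶠ t in 𝓝 (0 : ℝ), h (t, ψ t) = h 0 :=
    hh.eventually_apply_implicitFunction (by simp) hi
  have hψs : ContDiffAt ℝ ∞ ψ 0 := hh.contDiffAt_implicitFunction (by simp) hi
  have hψd : HasFDerivAt ψ (0 : ℝ →L[ℝ] F) 0 := by
    have := (hh.hasStrictFDerivAt_implicitFunction (by simp) hi).hasFDerivAt
    rw [hinl, ContinuousLinearMap.comp_zero, neg_zero] at this
    exact this
  let γ : ℝ → EuclideanSpace ℝ (Fin n) := fun t => x + a (t, ψ t)
  have hγ0 : γ 0 = x := by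
    have : a (0, 0) = 0 := map_zero a
    simp [γ, hψ0, this]
  have hγs : ContDiffAt ℝ ∞ γ 0 :=
    contDiffAt_const.add (a.contDiff.contDiffAt.comp 0 (contDiffAt_id.prodMk hψs))
  refine Submodule.subset_span ⟨γ, hγs, hγ0, ?_, ?_⟩
  · have hγc : Tendsto γ (𝓝 0) (𝓝 x) := by
      have := hγs.continuousAt.tendsto
      rwa [hγ0] at this
    filter_upwards [hγc.eventually hA, hψ] with t h1 h2
    refine h1 ?_
    simpa [h] using h2
  · have h1 : HasDerivAt ψ 0 0 := by simpa using hψd.hasDerivAt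
    have h2 := ((hasDerivAt_id (0 : ℝ)).smul_const v).add (R.hasFDerivAt.comp_hasDerivAt 0 h1)
    simpa [γ, a, Function.comp_def] using h2.const_add x

/-- Limits of tangent spaces of an open part `X` of a regular level set contain the tangent space
of the level set. -/
theorem mem_limit_tangent {g : EuclideanSpace ℝ (Fin n) → F} (hg : ContDiff ℝ ∞ g)
    {X : Set (EuclideanSpace ℝ (Fin n))} {q : F}
    (hX : ∀ x ∈ X, ∀ᶠ z in 𝓝 x, g z = q → z ∈ X) (hXq : ∀ x ∈ X, g x = q)
    (hsurj : ∀ z, g z = q → Function.Surjective (fderiv ℝ g z))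
    {y v : EuclideanSpace ℝ (Fin n)} (hy : g y = q) {x : ℕ → EuclideanSpace ℝ (Fin n)}
    {τ : Submodule ℝ (EuclideanSpace ℝ (Fin n))} (hx : ∀ k, x k ∈ X)
    (hxy : Tendsto x atTop (𝓝 y)) (hτ : SubspaceTendsto (fun k => tangent X (x k)) τ)
    (hv0 : fderiv ℝ g y v = 0) : v ∈ τ := by
  have hc : Tendsto (fun k => fderiv ℝ g (x k)) atTop (𝓝 (fderiv ℝ g y)) :=
    ((hg.continuous_fderiv (by simp)).tendsto y).comp hxy
  have hu : Tendsto (fun k => fderiv ℝ g (x k) v) atTop (𝓝 0) := by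
    simpa [hv0] using tendsto_clm_apply hc (tendsto_const_nhds (x := v))
  obtain ⟨w, hw, hwv⟩ := exists_mem_ker_tendsto_sub hc (hsurj y hy) hu
  refine mem_of_tendsto_subspace (v := w) hτ ?_ (by simpa using hwv.add_const v)
  filter_upwards [hw] with k hk
  refine ker_fderiv_le_tangent hg (hsurj _ (hXq _ (hx k))) ?_ hk
  rw [hXq _ (hx k)]
  exact hX _ (hx k)

/-- Whitney's condition (a) when `X` is an open part of a regular level set containing `Y`. -/
theorem whitneyA_of_submersion {g : EuclideanSpace ℝ (Fin n) → F} (hg : ContDiff ℝ ∞ g)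
    {X Y : Set (EuclideanSpace ℝ (Fin n))} {q : F}
    (hX : ∀ x ∈ X, ∀ᶠ z in 𝓝 x, g z = q → z ∈ X) (hXq : ∀ x ∈ X, g x = q)
    (hYq : ∀ y ∈ Y, g y = q) (hsurj : ∀ z, g z = q → Function.Surjective (fderiv ℝ g z)) :
    WhitneyA X Y := by
  intro y hy x τ hx hxy hτ v hv
  have hv0 : fderiv ℝ g y v = 0 := tangent_le_ker_fderiv (hg.differentiable (by simp) y)
    (fun z hz => (hYq z hz).trans (hYq y hy).symm) hv
  exact mem_limit_tangent hg hX hXq hsurj (hYq y hy) hx hxy hτ hv0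

/-- Whitney's condition (b) when `X` is an open part of a regular level set containing `Y`. -/
theorem whitneyB_of_submersion {g : EuclideanSpace ℝ (Fin n) → F} (hg : ContDiff ℝ ∞ g)
    {X Y : Set (EuclideanSpace ℝ (Fin n))} {q : F}
    (hX : ∀ x ∈ X, ∀ᶠ z in 𝓝 x, g z = q → z ∈ X) (hXq : ∀ x ∈ X, g x = q)
    (hYq : ∀ y ∈ Y, g y = q) (hsurj : ∀ z, g z = q → Function.Surjective (fderiv ℝ g z)) :
    WhitneyB X Y := by
  intro y hy x z l τ hx hz hne hxy hzy hl hτ v hv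
  let p (k : ℕ) := (Submodule.span ℝ {x k - z k}).starProjection v
  have hp : Tendsto p atTop (𝓝 v) := by
    have := tendsto_clm_apply hl (tendsto_const_nhds (x := v))
    rwa [Submodule.starProjection_eq_self_iff.2 hv] at this
  -- Strict differentiability handles both moving end points: as `g (x k) = g (z k)`, the derivative
  -- at `y` of the secant vector is small relative to its length.
  have hstrict : HasStrictFDerivAt g (fderiv ℝ g y) y := hg.contDiffAt.hasStrictFDerivAt (by simp)
  have hlim : Tendsto (fun k => fderiv ℝ g y (p k)) atTop (𝓝 0) := by
    rw [Metric.tendsto_nhds]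
    intro ε hε
    -- The `+ 1` allows `v = 0` and makes the final inequality strict.
    have hε' : 0 < ε / (‖v‖ + 1) := by positivity
    have ho := (hstrict.isLittleO.def hε')
    have := (hxy.prodMk_nhds hzy).eventually ho
    filter_upwards [this] with k hk
    rw [hXq _ (hx k), hYq _ (hz k), sub_self, zero_sub, norm_neg] at hk
    obtain ⟨c, hc⟩ := Submodule.mem_span_singleton.1
      ((Submodule.span ℝ {x k - z k}).starProjection_apply_mem v)
    have hpk : p k = c • (x k - z k) := hc.symm
    have hle : ‖p k‖ ≤ ‖v‖ := Submodule.norm_starProjection_apply_le _ v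
    rw [dist_zero_right, hpk, map_smul, norm_smul]
    calc ‖c‖ * ‖fderiv ℝ g y (x k - z k)‖ ≤ ‖c‖ * (ε / (‖v‖ + 1) * ‖x k - z k‖) := by gcongr
      _ = ε / (‖v‖ + 1) * ‖p k‖ := by rw [hpk, norm_smul]; ring
      _ ≤ ε / (‖v‖ + 1) * ‖v‖ := by gcongr
      _ < ε / (‖v‖ + 1) * (‖v‖ + 1) := by gcongr; linarith
      _ = ε := by field_simp
  have hv0 : fderiv ℝ g y v = 0 :=
    tendsto_nhds_unique (((fderiv ℝ g y).continuous.tendsto v).comp hp) hlim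
  exact mem_limit_tangent hg hX hXq hsurj (hYq y hy) hx hxy hτ hv0

end Tangent

/-! ### The strata as open pieces of regular level sets -/

section Strata

open Filter

variable {n s : ℕ}

/-- The stratum with sign vector `c`: `|fᵢ| < |eᵢ|` if `cᵢ = 0`, and `fᵢ = cᵢ eᵢ` otherwise. -/
def stratum (f : Fin s → MvPolynomial (Fin n) ℝ) (e : Fin s → ℝ) (c : Fin s → SignType) :
    Set (EuclideanSpace ℝ (Fin n)) :=
  {p | ∀ i, if c i = 0 then |realMap f p i| < |e i| else realMap f p i = (c i : ℝ) * e i}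

theorem mem_uIoo_neg_iff {a y : ℝ} : y ∈ Set.uIoo (-a) a ↔ |y| < |a| := by
  rcases le_total 0 a with h | h
  · rw [Set.uIoo_of_le (by linarith), abs_of_nonneg h, abs_lt, Set.mem_Ioo]
  · rw [Set.uIoo_of_ge (by linarith), abs_of_nonpos h, abs_lt, Set.mem_Ioo, neg_neg]

/-- Sign vectors make the family visibly finite. The indexing need not be injective: the signs `1`
and `-1` agree where `e i = 0`. -/
theorem pullbackStratification_eq_range (f : Fin s → MvPolynomial (Fin n) ℝ) (e : Fin s → ℝ) :
    pullbackStratification f e = Set.range (stratum f e) := by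
  ext X
  constructor
  · rintro ⟨_, ⟨I, hI, rfl⟩, rfl⟩
    have key (i : Fin s) : ∃ σ : SignType, ∀ y : ℝ, y ∈ I i ↔
        if σ = 0 then |y| < |e i| else y = (σ : ℝ) * e i := by
      rcases hI i with h | h | h
      · exact ⟨-1, fun y => by simp [h]⟩
      · exact ⟨0, fun y => by simp [h, mem_uIoo_neg_iff]⟩
      · exact ⟨1, fun y => by simp [h]⟩
    choose c hc using key
    refine ⟨c, ?_⟩
    ext p
    simp [stratum, hc]
  · rintro ⟨c, rfl⟩
    refine ⟨_, ⟨fun i => if c i = 0 then Set.uIoo (-e i) (e i) else {(c i : ℝ) * e i}, fun i => ?_,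
      rfl⟩, ?_⟩
    · cases h : c i <;> simp [h]
    · ext p
      simp only [stratum, Set.mem_preimage, Set.mem_pi, Set.mem_univ, forall_true_left,
        Set.mem_ofPred_eq]
      refine forall_congr' fun i => ?_
      split_ifs <;> simp [mem_uIoo_neg_iff]

/-- The indices of the constraints that are equalities on the stratum with sign vector `c`. -/
def activeSet (c : Fin s → SignType) : Finset (Fin s) := Finset.univ.filter fun i => c i ≠ 0

theorem mem_activeSet {c : Fin s → SignType} {i : Fin s} : i ∈ activeSet c ↔ c i ≠ 0 := by
  simp [activeSet]

/-- The components of `F` with index in `I`. -/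
def partialMap (f : Fin s → MvPolynomial (Fin n) ℝ) (I : Finset (Fin s))
    (x : EuclideanSpace ℝ (Fin n)) : I → ℝ :=
  fun i => realMap f x i

/-- The value of the components with index in `activeSet c` on the stratum. -/
def activeValue (e : Fin s → ℝ) (c : Fin s → SignType) : activeSet c → ℝ :=
  fun i => (c i : ℝ) * e i

theorem contDiff_partialMap (f : Fin s → MvPolynomial (Fin n) ℝ) (I : Finset (Fin s)) :
    ContDiff ℝ ∞ (partialMap f I) :=
  contDiff_pi.2 fun i => contDiff_pi.1 (contDiff_realMap f) i

theorem continuous_realMap (f : Fin s → MvPolynomial (Fin n) ℝ) : Continuous (realMap f) :=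
  (contDiff_realMap f).continuous

variable {f : Fin s → MvPolynomial (Fin n) ℝ} {e : Fin s → ℝ} {c d : Fin s → SignType}

theorem mem_stratum_iff {p : EuclideanSpace ℝ (Fin n)} : p ∈ stratum f e c ↔
    partialMap f (activeSet c) p = activeValue e c ∧
      ∀ i, i ∉ activeSet c → |realMap f p i| < |e i| := by
  simp only [stratum, Set.mem_ofPred_eq, funext_iff, partialMap, activeValue, Subtype.forall,
    mem_activeSet, not_not]
  refine ⟨fun h => ⟨fun i hi => by simpa [hi] using h i, fun i hi => by simpa [hi] using h i⟩,
    fun h i => ?_⟩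
  split_ifs with hi
  exacts [h.2 i hi, h.1 i hi]

theorem isOpen_inactive (f : Fin s → MvPolynomial (Fin n) ℝ) (e : Fin s → ℝ) (I : Finset (Fin s)) :
    IsOpen {p | ∀ i, i ∉ I → |realMap f p i| < |e i|} := by
  simp only [Set.ofPred_forall]
  refine isOpen_iInter_of_finite fun i => isOpen_iInter_of_finite fun _ => ?_
  exact isOpen_lt (continuous_abs.comp ((continuous_apply i).comp (continuous_realMap f)))
    continuous_const

/-- Regularity holds on the whole level set, not only on the stratum, so it also covers limit
points. -/
theorem surjective_fderiv_partialMap (h : checkWhitneyStratification f e = true)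
    {x : EuclideanSpace ℝ (Fin n)} (hx : partialMap f (activeSet c) x = activeValue e c) :
    Function.Surjective (fderiv ℝ (partialMap f (activeSet c)) x) := by
  have h1 (i : activeSet c) : ∃ u : ℤˣ, ((u : ℤ) : ℝ) = (c i : ℝ) := by
    have := mem_activeSet.1 i.2
    cases hc : c i
    · exact absurd hc this
    · exact ⟨-1, by simp⟩
    · exact ⟨1, by simp⟩
  choose σ hσ using h1
  have h2 := (testIdeal_eq_top_iff f e _ σ).2 ((check_eq_true_iff_forall f e).1 h _ σ)
  have h3 := surjective_fderiv_realMap h2 (x := x) fun i => by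
    rw [hσ]
    exact congrFun hx i
  convert! h3 using 1
  ext v i
  have hd := ((contDiff_realMap f).differentiable (by simp) x).hasFDerivAt
  have hp : HasFDerivAt (partialMap f (activeSet c)) _ x :=
    hasFDerivAt_pi.2 fun i : activeSet c => hasFDerivAt_pi'.1 hd i
  rw [hp.fderiv]
  rfl

theorem isSubmanifold_stratum (h : checkWhitneyStratification f e = true) :
    IsSubmanifold (stratum f e c) := by
  intro x hx
  rw [mem_stratum_iff] at hx
  let E : (activeSet c → ℝ) ≃L[ℝ] (Fin (activeSet c).card → ℝ) :=
    ContinuousLinearEquiv.piCongrLeft ℝ (fun _ => ℝ) (activeSet c).equivFin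
  let g := partialMap f (activeSet c)
  have hg : ContDiff ℝ ∞ g := contDiff_partialMap f _
  refine ⟨(activeSet c).card, {p | ∀ i, i ∉ activeSet c → |realMap f p i| < |e i|} ∩
    fderiv ℝ g ⁻¹' {A | Function.Surjective A}, fun z => E (g z - activeValue e c),
    (isOpen_inactive f e _).inter
      (isOpen_setOf_surjective.preimage (hg.continuous_fderiv (by simp))),
    ⟨hx.2, surjective_fderiv_partialMap h hx.1⟩, ?_, ?_, ?_⟩
  · exact (E.contDiff.comp (hg.sub contDiff_const)).contDiffOn
  · rintro z ⟨-, hz⟩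
    have h1 : HasFDerivAt (fun z => E (g z - activeValue e c))
        ((E : _ →L[ℝ] _) ∘L fderiv ℝ g z) z :=
      E.hasFDerivAt.comp z ((hg.differentiable (by simp) z).hasFDerivAt.sub_const _)
    rw [h1.fderiv]
    exact E.surjective.comp hz
  · ext z
    simp only [Set.mem_inter_iff, mem_stratum_iff, Set.mem_ofPred_eq, map_eq_zero_iff E E.injective,
      sub_eq_zero, g]
    tauto

/-- If a point of a stratum is adherent to another one, then the equalities that hold on the latter
also hold on the former. -/
theorem eq_of_mem_closure {y : EuclideanSpace ℝ (Fin n)} (hy : y ∈ stratum f e d)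
    (hyc : y ∈ closure (stratum f e c)) :
    activeSet c ⊆ activeSet d ∧ ∀ z ∈ stratum f e d,
      partialMap f (activeSet c) z = activeValue e c := by
  have h1 : partialMap f (activeSet c) y = activeValue e c := by
    have hcl : IsClosed {p | partialMap f (activeSet c) p = activeValue e c} :=
      isClosed_eq (contDiff_partialMap f _).continuous continuous_const
    exact closure_minimal (fun p hp => (mem_stratum_iff.1 hp).1) hcl hyc
  have hsub : activeSet c ⊆ activeSet d := by
    intro i hi
    by_contra hid
    have h2 := (mem_stratum_iff.1 hy).2 i hid
    have h3 : realMap f y i = (c i : ℝ) * e i := congrFun h1 ⟨i, hi⟩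
    rw [h3, abs_mul] at h2
    have hi' := mem_activeSet.1 hi
    cases hc : c i <;> simp [hc] at h2 hi'
  refine ⟨hsub, fun z hz => ?_⟩
  rw [← h1]
  ext i
  have h2 := congrFun ((mem_stratum_iff.1 hz).1.trans (mem_stratum_iff.1 hy).1.symm) ⟨i, hsub i.2⟩
  exact h2

theorem eventually_mem_stratum {x : EuclideanSpace ℝ (Fin n)} (hx : x ∈ stratum f e c) :
    ∀ᶠ z in 𝓝 x, partialMap f (activeSet c) z = activeValue e c → z ∈ stratum f e c := by
  filter_upwards [(isOpen_inactive f e _).mem_nhds (mem_stratum_iff.1 hx).2] with z hz hz'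
  exact mem_stratum_iff.2 ⟨hz', hz⟩

theorem frontier_stratum (h : checkWhitneyStratification f e = true)
    (hne : (stratum f e d ∩ closure (stratum f e c)).Nonempty) :
    stratum f e d ⊆ closure (stratum f e c) := by
  obtain ⟨y₀, hy₀, hy₀c⟩ := hne
  obtain ⟨hsub, heq⟩ := eq_of_mem_closure hy₀ hy₀c
  obtain ⟨x₀, hx₀⟩ : (stratum f e c).Nonempty := closure_nonempty_iff.1 ⟨y₀, hy₀c⟩
  intro y hy
  have hyd := mem_stratum_iff.1 hy
  have hsurj := surjective_fderiv_partialMap h hyd.1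
  have hmap := HasStrictFDerivAt.map_nhds_eq_of_surj
    ((contDiff_partialMap f (activeSet d)).contDiffAt.hasStrictFDerivAt (x := y) (by simp))
    (LinearMap.range_eq_top.2 hsurj)
  -- The values of the components active for `d` that are allowed on the stratum of `c`, written
  -- with the values of `d` where both are active.
  let W : Set (activeSet d → ℝ) := 
    {w | ∀ i : activeSet d, if c i = 0 then |w i| < |e i| else w i = activeValue e d i}
  have hW : partialMap f (activeSet d) y ∈ closure W := by
    rw [hyd.1]
    -- Shrinking by `1 - t` the coordinates that `c` releases moves the value into `W` for `0 < t <
    -- 1`.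
    let w (t : ℝ) (i : activeSet d) : ℝ :=
      if c i = 0 then (1 - t) * activeValue e d i else activeValue e d i
    have hw : Continuous w := by
      refine continuous_pi fun i => ?_
      by_cases hi : c i = 0
      · simp only [w, hi, if_true]; fun_prop
      · simp only [w, hi, if_false]; fun_prop
    have hw0 : w 0 = activeValue e d := by ext i; simp [w]
    have hlim : Tendsto w (𝓝[>] 0) (𝓝 (activeValue e d)) :=
      (hw0 ▸ hw.tendsto 0).mono_left nhdsWithin_le_nhds
    refine mem_closure_of_tendsto hlim ?_
    filter_upwards [Ioo_mem_nhdsGT (zero_lt_one' ℝ)] with t ht i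
    split_ifs with hi
    · have he : 0 < |e i| :=
        (abs_nonneg _).trans_lt ((mem_stratum_iff.1 hx₀).2 i (by simpa [mem_activeSet] using hi))
      have hd : |((d i : SignType) : ℝ)| = 1 := by
        have := mem_activeSet.1 i.2
        cases hc : d i <;> simp [hc] at this ⊢
      simp only [w, hi, if_true, activeValue, abs_mul, hd, one_mul]
      rw [abs_of_pos (by linarith [ht.2])]
      nlinarith [ht.1]
    · simp [w, hi]
  rw [mem_closure_iff_nhds]
  intro U hU
  have hU' := inter_mem hU ((isOpen_inactive f e _).mem_nhds hyd.2)
  -- Since the map is open at `y`, values in `W` near its value at `y` lift to points near `y` where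
  -- the inactive inequalities persist.
  obtain ⟨w, ⟨z, ⟨hzU, hz⟩, rfl⟩, hwW⟩ :=
    mem_closure_iff_nhds.1 hW _ (hmap ▸ image_mem_map hU')
  refine ⟨z, hzU, fun i => ?_⟩
  by_cases hid : i ∈ activeSet d
  · have h1 := hwW ⟨i, hid⟩
    split_ifs with hi
    · simp only [hi, if_true] at h1
      exact h1
    · simp only [hi, if_false] at h1
      have h2 : realMap f y i = activeValue e d ⟨i, hid⟩ := congrFun hyd.1 ⟨i, hid⟩
      have h3 : realMap f y i = (c i : ℝ) * e i := congrFun (heq y hy) ⟨i, mem_activeSet.2 hi⟩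
      exact (h1.trans h2.symm).trans h3
  · have hi : c i = 0 := by
      by_contra hi
      exact hid (hsub (mem_activeSet.2 hi))
    simpa [hi] using hz i hid

/-- A common point lies in both closures, so `eq_of_mem_closure` in both directions gives the same
active set and the same equations. -/
theorem disjoint_stratum (hne : stratum f e c ≠ stratum f e d) :
    Disjoint (stratum f e c) (stratum f e d) := by
  rw [Set.disjoint_left]
  intro p hc hd
  refine hne ?_
  have hdc := (eq_of_mem_closure hd (subset_closure hc))
  have hcd := (eq_of_mem_closure hc (subset_closure hd))
  have hI : activeSet c = activeSet d := hdc.1.antisymm hcd.1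
  ext z
  constructor
  · intro hz
    exact mem_stratum_iff.2 ⟨hcd.2 z hz, hI ▸ (mem_stratum_iff.1 hz).2⟩
  · intro hz
    exact mem_stratum_iff.2 ⟨hdc.2 z hz, hI ▸ (mem_stratum_iff.1 hz).2⟩

theorem mem_thickening_iff {p : EuclideanSpace ℝ (Fin n)} :
    p ∈ thickening f e ↔ ∃ c, p ∈ stratum f e c := by
  refine Iff.trans (forall_congr' fun i => ?_) (Classical.skolem (b := fun _ => SignType)
    (p := fun i σ => if σ = 0 then |realMap f p i| < |e i| else realMap f p i = (σ : ℝ) * e i))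
  constructor
  · intro h
    rcases h.lt_or_eq with h | h
    · exact ⟨0, by simpa using h⟩
    · rcases abs_eq_abs.1 h with h | h
      · exact ⟨1, by simpa using h⟩
      · exact ⟨-1, by simpa using h⟩
  · rintro ⟨σ, hσ⟩
    cases σ
    · exact le_of_lt (by simpa using hσ)
    · have : realMap f p i = -e i := by simpa using hσ
      simp [this]
    · have : realMap f p i = e i := by simpa using hσ
      simp [this]

theorem isWhitneyStratification_pullback (h : checkWhitneyStratification f e = true) :
    IsWhitneyStratification (thickening f e) (pullbackStratification f e) := by
  rw [pullbackStratification_eq_range]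
  have hfin : (Set.range (stratum f e)).Finite := Set.finite_range _
  have hclosure {X : Set (EuclideanSpace ℝ (Fin n))} {y : EuclideanSpace ℝ (Fin n)}
      {x : ℕ → EuclideanSpace ℝ (Fin n)} (hx : ∀ k, x k ∈ X) (hxy : Tendsto x atTop (𝓝 y)) :
      y ∈ closure X :=
    mem_closure_of_tendsto hxy (Eventually.of_forall hx)
  refine ⟨?_, ?_, fun x _ => ⟨Set.univ, univ_mem, hfin.subset fun A hA => hA.1⟩, ?_, ?_, ?_, ?_⟩
  · ext p
    rw [mem_thickening_iff]
    simp
  · rintro _ ⟨c, rfl⟩ _ ⟨d, rfl⟩ hne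
    exact disjoint_stratum hne
  · rintro _ ⟨c, rfl⟩
    exact isSubmanifold_stratum h
  · rintro _ ⟨c, rfl⟩ _ ⟨d, rfl⟩ hne
    exact frontier_stratum h hne
  · rintro _ ⟨c, rfl⟩ _ ⟨d, rfl⟩ - y hy x τ hx hxy
    -- The sequence puts `y` in the closure of the first stratum, so the second lies in its level
    -- set; otherwise there is nothing to prove.
    exact whitneyA_of_submersion (contDiff_partialMap f _) (fun _ => eventually_mem_stratum)
      (fun _ hz => (mem_stratum_iff.1 hz).1) (eq_of_mem_closure hy (hclosure hx hxy)).2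
      (fun _ => surjective_fderiv_partialMap h) y hy x τ hx hxy
  · rintro _ ⟨c, rfl⟩ _ ⟨d, rfl⟩ - y hy x z l τ hx hz hne hxy
    exact whitneyB_of_submersion (contDiff_partialMap f _) (fun _ => eventually_mem_stratum)
      (fun _ hz => (mem_stratum_iff.1 hz).1) (eq_of_mem_closure hy (hclosure hx hxy)).2
      (fun _ => surjective_fderiv_partialMap h) y hy x z l τ hx hz hne hxy

end Strata

end CheckWhitney

end

theorem mainTheorem12 (n s : ℕ) (f : Fin s → MvPolynomial (Fin n) ℝ) :
    -- the algorithm returns true for generic `e`, that is, on a nonempty Zariski open set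
    (∃ P : MvPolynomial (Fin s) ℝ, P ≠ 0 ∧ ∀ e : Fin s → ℝ,
      MvPolynomial.eval e P ≠ 0 → CheckWhitney.checkWhitneyStratification f e = true) ∧
    -- if it returns true, the pullback is a Whitney stratification
    (∀ e : Fin s → ℝ, CheckWhitney.checkWhitneyStratification f e = true →
      CheckWhitney.IsWhitneyStratification (CheckWhitney.thickening f e)
        (CheckWhitney.pullbackStratification f e)) ∧
    -- each test of the loop decides whether `Y_{I,σ}` is empty
    (∀ (e : Fin s → ℝ) (I : Finset (Fin s)) (σ : I → ℤˣ),
      CheckWhitney.testIdeal f e I σ = ⊤ ↔ CheckWhitney.badVariety f e I σ = ∅) ∧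
    -- the algorithm returns true iff all `Y_{I,σ}` with `#I ≤ n + 1` are empty
    (∀ e : Fin s → ℝ, CheckWhitney.checkWhitneyStratification f e = true ↔
      ∀ (I : Finset (Fin s)) (σ : I → ℤˣ), I.card ≤ n + 1 →
        CheckWhitney.badVariety f e I σ = ∅) ∧
    -- equivalently, iff all `Y_{I,σ}` are empty
    (∀ e : Fin s → ℝ, CheckWhitney.checkWhitneyStratification f e = true ↔
      ∀ (I : Finset (Fin s)) (σ : I → ℤˣ), CheckWhitney.badVariety f e I σ = ∅) :=
  ⟨CheckWhitney.exists_generic f, fun _ => CheckWhitney.isWhitneyStratification_pullback,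
    CheckWhitney.testIdeal_eq_top_iff f, CheckWhitney.check_eq_true_iff f,
    CheckWhitney.check_eq_true_iff_forall f⟩
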